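/- All graphs are finite and simple. A $k$-edge-weighting of a graph $G$ is a map $w:E(G)\to\{1,\dots,k\}$; it induces the vertex coloring $c(v)=\sum_{e\ni v}w(e)$, and $w$ is a vertex-coloring $k$-edge-weighting (VC$k$-EW) if $c(u)\neq c(v)$ for all adjacent $u,v$. Let $\mu(G)$ be the minimum $k\ge 1$ for which $G$ has a VC$k$-EW ($\mu(G)=\infty$ if there is none). Let $\Box$ denote the cartesian product of graphs, and let $P_n$ and $C_n$ be the path and the cycle with $n$ vertices. Let $G$ and $H$ be connected bipartite graphs, each with at least two vertices, at least one of which does not admit a VC$1$-EW. Then $\mu(G\Box H)=2$. In particular: * $\mu(C_n\Box C_m)=2$ for all even $n,m\ge 4$; * $\mu(C_n\Box P_m)=2$ for all even $n\ge 4$ and all $m\ge 2$; * $\mu(P_n\Box P_m)=2$ for all $n,m\ge 2$ with $(n,m)\neq(3,3)$; * $\mu(Q_n)=2$ for all $n\ge 2$, where $Q_n=K_2\Box K_2\Box\cdots\Box K_2$ ($n$ factors) is the cube graph. -/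

import Mathlib

namespace VCEW

open Classical in
/-- The vertex coloring induced by an edge-weighting `w` of a finite graph: the color of `v` is
the sum of the weights of the edges incident to `v`. -/
noncomputable def inducedColoring {V : Type*} [Fintype V] {G : SimpleGraph V}
    (w : G.edgeSet → ℕ) (v : V) : ℕ :=
  ∑ e ∈ Finset.univ.filter (fun e : G.edgeSet => v ∈ (e : Sym2 V)), w e

/-- `w` is a vertex-coloring `k`-edge-weighting: all weights lie in `{1, …, k}`, and the induced
vertex coloring is proper. -/
def IsVCEW {V : Type*} [Fintype V] (G : SimpleGraph V) (k : ℕ) (w : G.edgeSet → ℕ) : Prop :=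
  (∀ e : G.edgeSet, 1 ≤ w e ∧ w e ≤ k) ∧
    ∀ u v : V, G.Adj u v → inducedColoring w u ≠ inducedColoring w v

/-- The graph `G` admits a vertex-coloring `k`-edge-weighting. -/
def AdmitsVCEW {V : Type*} [Fintype V] (G : SimpleGraph V) (k : ℕ) : Prop :=
  ∃ w : G.edgeSet → ℕ, IsVCEW G k w

/-- The minimum positive integer `k` such that `G` admits a vertex-coloring `k`-edge-weighting;
it is `⊤` if there is no such `k`. -/
noncomputable def mu {V : Type*} [Fintype V] (G : SimpleGraph V) : ℕ∞ :=
  ⨅ k ∈ {k : ℕ | 1 ≤ k ∧ AdmitsVCEW G k}, (k : ℕ∞)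

/-- The `n`-fold cartesian product `G □ G □ ⋯ □ G`: two tuples are adjacent if they differ in
exactly one coordinate, and their entries in that coordinate are adjacent in `G`. -/
def boxPower {V : Type*} (G : SimpleGraph V) (n : ℕ) : SimpleGraph (Fin n → V) where
  Adj x y := ∃ i : Fin n, G.Adj (x i) (y i) ∧ ∀ j : Fin n, j ≠ i → x j = y j
  symm := ⟨fun _ _ ⟨i, h, hj⟩ => ⟨i, h.symm, fun j hji => (hj j hji).symm⟩⟩
  loopless := ⟨fun _ ⟨_, h, _⟩ => G.irrefl h⟩

/-- The cube graph `Q_n = K_2 □ K_2 □ ⋯ □ K_2` (`n` factors). -/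
def cubeGraph (n : ℕ) : SimpleGraph (Fin n → Fin 2) :=
  boxPower (SimpleGraph.completeGraph (Fin 2)) n

end VCEW

/-!
Weights 1 and 2 are encoded by residues modulo 2 (`wt`), so that the parity of the induced coloring
is the boundary `bd` of a chain over `ZMod 2`. In a connected graph every function on the vertices
with sum zero is a boundary (`exists_bd_eq`, the existence of `T`-joins). Hence, if some part of a
connected bipartite graph has even size, its vertices can get odd colors and the others even colors
(`admitsVCEW_two_of_sum_side_eq_zero`).

Suppose both parts of `G □ H` are odd. Fix a vertex `v = (g, h)`, give weight 2 to all its edges, and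
make the colors of the rest of its part odd and those of the other part even. This is possible since
`G □ H` has no cut vertex (`exists_parity_boxProd`), and conflicts can occur only between `v`, whose
color is `2 deg v`, and its neighbors. A neighbor `(a, h)` with `deg a ≥ 2` lies on 4-cycles
`(a, h), (a', h), (a', b), (a, b)` with `a' ≠ g`, which avoid `v` and its other neighbors; exchanging
the two weights along one or two of them keeps all parities and changes the color of `(a, h)` by 2
(`exists_flip`). The same holds with the factors exchanged, so conflicts are removed one at a time
(`admitsVCEW_two_of_flips`). If both factors have a vertex of degree at least 2, take `g` and `h` to
be such vertices: neighbors without a 4-cycle of this kind have too small a degree to conflict.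

If `G` is an edge `g g'`, the neighbor `(g', h)` of `v` has the degree of `v` and admits no flip, so
it must be given an edge of weight 1 beforehand. A suitable `h` is found next to, or at, a non-cut
vertex of `H` (`admitsVCEW_two_of_edge`). If both factors are edges, the product is a 4-cycle, with
parts of size 2.

For the lower bound, a graph admits a vertex-coloring 1-edge-weighting if and only if adjacent
vertices have distinct degrees, and an edge of `G` or `H` with ends of equal degree gives such an
edge of `G □ H`.
-/

namespace VCEW

open SimpleGraph Finset

/-! ### Weights in {1, 2} as residues modulo 2 -/

section Weights

open Classical in
/-- The finite set of neighbors of `p`, with classical decidability throughout. -/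
noncomputable def nbrs {T : Type*} [Fintype T] (Γ : SimpleGraph T) (p : T) : Finset T :=
  univ.filter (Γ.Adj p)

/-- The edge weight encoded by a residue modulo 2: the weight in `{1, 2}` of the same parity. -/
def wt (a : ZMod 2) : ℕ := if a = 0 then 2 else 1

/-- The vertex color induced by the edge weights `wt ∘ x`. -/
noncomputable def col {T : Type*} [Fintype T] (Γ : SimpleGraph T) (x : Sym2 T → ZMod 2) (p : T) :
    ℕ :=
  ∑ q ∈ nbrs Γ p, wt (x s(p, q))

/-- The boundary of `x` over `ZMod 2`: at each vertex, the parity of its color. -/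
noncomputable def bd {T : Type*} [Fintype T] (Γ : SimpleGraph T) (x : Sym2 T → ZMod 2) (p : T) :
    ZMod 2 :=
  ∑ q ∈ nbrs Γ p, x s(p, q)

variable {T : Type*} [Fintype T] {Γ : SimpleGraph T}

@[simp]
lemma mem_nbrs {p q : T} : q ∈ nbrs Γ p ↔ Γ.Adj p q := by
  simp [nbrs]

lemma wt_cast (a : ZMod 2) : (wt a : ZMod 2) = a := by
  revert a; decide

lemma wt_le (a : ZMod 2) : wt a ≤ 2 := by
  revert a; decide

lemma one_le_wt (a : ZMod 2) : 1 ≤ wt a := by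
  revert a; decide

lemma col_cast (x : Sym2 T → ZMod 2) (p : T) : (col Γ x p : ZMod 2) = bd Γ x p := by
  simp [col, bd, wt_cast]

lemma add_self_fun {α : Type*} (f : α → ZMod 2) : f + f = 0 :=
  funext fun _ => CharTwo.add_self_eq_zero _

lemma bd_add (x z : Sym2 T → ZMod 2) : bd Γ (x + z) = bd Γ x + bd Γ z := by
  ext p
  simp [bd, sum_add_distrib]

lemma bd_sum {ι : Type*} (s : Finset ι) (z : ι → Sym2 T → ZMod 2) :
    bd Γ (∑ i ∈ s, z i) = ∑ i ∈ s, bd Γ (z i) := by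
  ext p
  simp only [bd, Finset.sum_apply]
  exact sum_comm

lemma bd_single [DecidableEq T] {p q : T} (h : Γ.Adj p q) :
    bd Γ (Pi.single s(p, q) 1) = Pi.single p 1 + Pi.single q 1 := by
  ext r
  simp only [bd, Pi.single_apply, Pi.add_apply]
  have hne := h.ne
  by_cases hp : r = p
  · subst hp
    have : ∀ u ∈ nbrs Γ r, (if s(r, u) = s(r, q) then (1 : ZMod 2) else 0)
        = if u = q then 1 else 0 := by
      intro u _
      simp [hne]
    rw [sum_congr rfl this]
    simp [h, hne]
  · by_cases hq : r = q
    · subst hq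
      have : ∀ u ∈ nbrs Γ r, (if s(r, u) = s(p, r) then (1 : ZMod 2) else 0)
          = if u = p then 1 else 0 := by
        intro u _
        rw [Sym2.eq_swap (a := p)]
        simp [hp]
      rw [sum_congr rfl this]
      simp [h.symm, hp]
    · rw [sum_eq_zero]
      · simp [hp, hq]
      · intro u _
        rw [if_neg]
        simp [hp, hq]

lemma col_congr {x z : Sym2 T → ZMod 2} {p : T} (h : ∀ q, z s(p, q) = 0) :
    col Γ (x + z) p = col Γ x p := by
  simp [col, h]

lemma col_le (x : Sym2 T → ZMod 2) (p : T) : col Γ x p ≤ 2 * #(nbrs Γ p) := by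
  rw [mul_comm]
  exact (sum_le_card_nsmul _ _ 2 fun q _ => wt_le _).trans (by simp)

lemma col_eq_of_forall {x : Sym2 T → ZMod 2} {p : T} (h : ∀ q, x s(p, q) = 0) :
    col Γ x p = 2 * #(nbrs Γ p) := by
  simp [col, h, wt, mul_comm]

lemma col_lt {x : Sym2 T → ZMod 2} {p q : T} (h : Γ.Adj p q) (hx : x s(p, q) ≠ 0) :
    col Γ x p < 2 * #(nbrs Γ p) := by
  have : ∑ _q ∈ nbrs Γ p, 2 = 2 * #(nbrs Γ p) := by simp [mul_comm]
  rw [← this]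
  exact sum_lt_sum (fun q _ => wt_le _) ⟨q, by simpa using h, by simp [wt, hx]⟩

open Classical in
lemma inducedColoring_eq_sum (w : Γ.edgeSet → ℕ) (f : Sym2 T → ℕ) (hf : ∀ e, w e = f e) (p : T) :
    inducedColoring w p = ∑ q ∈ nbrs Γ p, f s(p, q) := by
  unfold inducedColoring
  symm
  refine sum_bij (fun q hq => ⟨s(p, q), by simpa using hq⟩) ?_ ?_ ?_ ?_
  · intro q hq
    simp
  · intro a ha b hb hab
    exact Sym2.congr_right.1 (congrArg Subtype.val hab)
  · rintro ⟨e, he⟩ hpe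
    simp only [mem_filter, mem_univ, true_and] at hpe
    obtain ⟨q, rfl⟩ := Sym2.mem_iff_exists.1 hpe
    exact ⟨q, by simpa using he, rfl⟩
  · intro q hq
    rw [hf]

lemma admitsVCEW_two_of_col (x : Sym2 T → ZMod 2)
    (h : ∀ p q, Γ.Adj p q → col Γ x p ≠ col Γ x q) : AdmitsVCEW Γ 2 := by
  refine ⟨fun e => wt (x e), fun e => ⟨one_le_wt _, wt_le _⟩, fun u v huv => ?_⟩
  rw [inducedColoring_eq_sum _ (fun e => wt (x e)) (fun _ => rfl),
    inducedColoring_eq_sum _ (fun e => wt (x e)) (fun _ => rfl)]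
  exact h u v huv

/-- With all weights equal to 1 the induced color is the degree. -/
lemma admitsVCEW_one_iff :
    AdmitsVCEW Γ 1 ↔ ∀ p q, Γ.Adj p q → #(nbrs Γ p) ≠ #(nbrs Γ q) := by
  constructor
  · rintro ⟨w, hw, hc⟩ p q hpq
    have h1 : ∀ e, w e = (fun _ => 1 : Sym2 T → ℕ) e := fun e => le_antisymm (hw e).2 (hw e).1
    have := hc p q hpq
    rw [inducedColoring_eq_sum w (fun _ => 1) h1,
      inducedColoring_eq_sum w (fun _ => 1) h1] at this
    simpa using this
  · intro h
    refine ⟨fun _ => 1, fun _ => ⟨le_rfl, le_rfl⟩, fun p q hpq => ?_⟩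
    rw [inducedColoring_eq_sum _ (fun _ => 1) (fun _ => rfl),
      inducedColoring_eq_sum _ (fun _ => 1) (fun _ => rfl)]
    simpa using h p q hpq

lemma mu_eq_two (h1 : ¬ AdmitsVCEW Γ 1) (h2 : AdmitsVCEW Γ 2) : mu Γ = 2 := by
  apply le_antisymm
  · exact iInf₂_le (2 : ℕ) ⟨by norm_num, h2⟩
  · refine le_iInf₂ fun k hk => ?_
    have : k ≠ 1 := fun h => h1 (h ▸ hk.2)
    have : 2 ≤ k := by have := hk.1; omega
    exact_mod_cast this

end Weights

/-! ### Prescribed parities in connected graphs -/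

section Joins

variable {T : Type*} [Fintype T] {Γ A : SimpleGraph T}

lemma exists_bd_eq_of_reachable [DecidableEq T] (hA : A ≤ Γ) {p q : T} (h : A.Reachable p q) :
    ∃ z : Sym2 T → ZMod 2, (∀ a b, ¬ A.Adj a b → z s(a, b) = 0) ∧
      bd Γ z = Pi.single p 1 + Pi.single q 1 := by
  obtain ⟨w⟩ := h
  induction w with
  | nil =>
    refine ⟨0, by simp, ?_⟩
    rw [add_self_fun]
    ext p
    simp [bd]
  | @cons a b c hab w ih =>
    obtain ⟨z, hz, hbd⟩ := ih
    refine ⟨Pi.single s(a, b) 1 + z, ?_, ?_⟩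
    · intro u v huv
      have : s(u, v) ≠ s(a, b) := by
        intro h
        rw [← mem_edgeSet, h] at huv
        exact huv hab
      simp [hz u v huv, this]
    · rw [bd_add, hbd, bd_single (hA hab), add_assoc, ← add_assoc (Pi.single b 1),
        add_self_fun, zero_add]

/-- Existence of `T`-joins: a function on the vertices whose values sum to zero is a boundary of a
chain supported on `A` as soon as its support lies in one connected component of `A`. -/
lemma exists_bd_eq (hA : A ≤ Γ) (f : T → ZMod 2) (r : T) (hr : ∀ p, f p ≠ 0 → A.Reachable p r)
    (hf : ∑ p, f p = 0) :
    ∃ z : Sym2 T → ZMod 2, (∀ a b, ¬ A.Adj a b → z s(a, b) = 0) ∧ bd Γ z = f := by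
  classical
  choose! z hz hbd using fun p (hp : f p ≠ 0) => exists_bd_eq_of_reachable hA (hr p hp)
  refine ⟨∑ p with f p ≠ 0, z p, ?_, ?_⟩
  · intro a b hab
    rw [Finset.sum_apply]
    exact sum_eq_zero fun p hp => hz p (by simpa using hp) a b hab
  · have h1 : ∀ a : ZMod 2, a ≠ 0 → a = 1 := by decide
    rw [bd_sum, sum_congr rfl fun p hp => hbd p (by simpa using hp)]
    have : ∀ p ∈ univ.filter (fun p => f p ≠ 0),
        (Pi.single p 1 + Pi.single r 1 : T → ZMod 2) = Pi.single p (f p) + Pi.single r (f p) := by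
      intro p hp
      rw [h1 (f p) (by simpa using hp)]
    rw [sum_congr rfl this, sum_filter_of_ne, sum_add_distrib, univ_sum_single]
    · ext q
      by_cases hq : q = r
      · subst hq
        simp [hf]
      · simp [hq]
    · intro p _ hp h0
      exact hp (by simp [h0])

end Joins

/-! ### Repairing conflicts by flipping 4-cycles -/

section Flips

variable {T : Type*} [Fintype T] {Γ : SimpleGraph T}

open Classical in
lemma sum_wt_flip_ne {T : Type*} (N : Finset T) (f f' : T → ZMod 2) {a b : T} (ha : a ∈ N)
    (hb : b ∈ N) (hab : a ≠ b) (hfab : f a = f b)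
    (hf' : ∀ u, f' u = f u + ((if u = a then 1 else 0) + (if u = b then 1 else 0))) :
    ∑ u ∈ N, wt (f' u) ≠ ∑ u ∈ N, wt (f u) := by
  rw [← add_sum_erase _ _ ha, ← add_sum_erase _ _ ha,
    ← add_sum_erase (N.erase a) _ (mem_erase.2 ⟨hab.symm, hb⟩),
    ← add_sum_erase (N.erase a) _ (mem_erase.2 ⟨hab.symm, hb⟩)]
  have : ∀ u ∈ (N.erase a).erase b, wt (f' u) = wt (f u) := by
    intro u hu
    simp only [mem_erase] at hu
    simp [hf', hu.1, hu.2.1]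
  rw [sum_congr rfl this, hf' a, hf' b, hfab]
  simp only [hab, hab.symm, if_true, if_false, add_zero, zero_add]
  have : wt (f b + 1) ≠ wt (f b) := by
    generalize f b = t
    revert t; decide
  omega

/-- The chain of a 4-cycle `y a o b`: a cycle, described by its values at `y` and its support. -/
lemma exists_square {y a b o : T} (ha : Γ.Adj y a) (hb : Γ.Adj y b) (hao : Γ.Adj a o)
    (hbo : Γ.Adj b o) (hoy : o ≠ y) [DecidableEq T] :
    ∃ z : Sym2 T → ZMod 2, bd Γ z = 0 ∧
      (∀ u, z s(y, u) = (if u = a then 1 else 0) + (if u = b then 1 else 0)) ∧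
      ∀ p q, p ≠ y → p ≠ a → p ≠ b → p ≠ o → z s(p, q) = 0 := by
  refine ⟨Pi.single s(y, a) 1 + Pi.single s(y, b) 1 + (Pi.single s(a, o) 1 + Pi.single s(b, o) 1),
    ?_, ?_, ?_⟩
  · have key : ∀ s t u v : T → ZMod 2,
        s + t + (s + u) + (t + v + (u + v)) = s + s + (t + t) + (u + u) + (v + v) := by
      intros; abel
    rw [bd_add, bd_add, bd_add, bd_single ha, bd_single hb, bd_single hao, bd_single hbo, key]
    simp only [add_self_fun, add_zero]
  · intro u
    have h1 : s(y, u) ≠ s(a, o) := by simp [ha.ne, hoy.symm]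
    have h2 : s(y, u) ≠ s(b, o) := by simp [hb.ne, hoy.symm]
    simp [Pi.single_apply, h1, h2, ha.ne, hb.ne]
  · intro p q h1 h2 h3 h4
    have e1 : s(p, q) ≠ s(y, a) := by simp [h1, h2]
    have e2 : s(p, q) ≠ s(y, b) := by simp [h1, h3]
    have e3 : s(p, q) ≠ s(a, o) := by simp [h2, h4]
    have e4 : s(p, q) ≠ s(b, o) := by simp [h3, h4]
    simp [e1, e2, e3, e4]

/-- Suppose that the neighbors of `y` other than `v` form two nonempty sets `A` and `B` such that
every `a ∈ A` and `b ∈ B` lie on a 4-cycle through `y`. Flipping weights along one or two of these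
4-cycles preserves all parities, and changes the color of `y` if that color is at least 6: two of
the edges from `y` to `A ∪ B` carry equal weights, and flipping both changes the color by 2. -/
lemma exists_flip [DecidableEq T] (x : Sym2 T → ZMod 2) {v y : T} {A B : Finset T} {O : Set T}
    (hN : nbrs Γ y = insert v (A ∪ B)) (hv : v ∉ A ∪ B) (hA : A.Nonempty) (hB : B.Nonempty)
    (hO : ∀ a ∈ A, ∀ b ∈ B, ∃ o ∈ O, Γ.Adj a o ∧ Γ.Adj b o) (hy : y ∉ O)
    (hcol : 5 < col Γ x y) :
    ∃ z : Sym2 T → ZMod 2, bd Γ z = 0 ∧ col Γ (x + z) y ≠ col Γ x y ∧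
      ∀ p q, p ≠ y → p ∉ A → p ∉ B → p ∉ O → z s(p, q) = 0 := by
  have hAy : ∀ a ∈ A, Γ.Adj y a := fun a ha => by
    rw [← mem_nbrs, hN]; simp [ha]
  have hBy : ∀ b ∈ B, Γ.Adj y b := fun b hb => by
    rw [← mem_nbrs, hN]; simp [hb]
  have hsq : ∀ a ∈ A, ∀ b ∈ B, ∃ z : Sym2 T → ZMod 2, bd Γ z = 0 ∧
      (∀ u, z s(y, u) = (if u = a then 1 else 0) + (if u = b then 1 else 0)) ∧
      ∀ p q, p ≠ y → p ∉ A → p ∉ B → p ∉ O → z s(p, q) = 0 := by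
    intro a ha b hb
    obtain ⟨o, ho, hao, hbo⟩ := hO a ha b hb
    obtain ⟨z, h1, h2, h3⟩ := exists_square (hAy a ha) (hBy b hb) hao hbo
      (fun h => hy (h ▸ ho))
    exact ⟨z, h1, h2, fun p q e1 e2 e3 e4 => h3 p q e1 (fun h => e2 (h ▸ ha))
      (fun h => e3 (h ▸ hb)) (fun h => e4 (h ▸ ho))⟩
  have hadd : ∀ a b c : T, ∀ z z' : Sym2 T → ZMod 2,
      (bd Γ z = 0 ∧ (∀ u, z s(y, u) = (if u = a then 1 else 0) + (if u = c then 1 else 0)) ∧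
        ∀ p q, p ≠ y → p ∉ A → p ∉ B → p ∉ O → z s(p, q) = 0) →
      (bd Γ z' = 0 ∧ (∀ u, z' s(y, u) = (if u = b then 1 else 0) + (if u = c then 1 else 0)) ∧
        ∀ p q, p ≠ y → p ∉ A → p ∉ B → p ∉ O → z' s(p, q) = 0) →
      ∃ z : Sym2 T → ZMod 2, bd Γ z = 0 ∧
        (∀ u, z s(y, u) = (if u = a then 1 else 0) + (if u = b then 1 else 0)) ∧
        ∀ p q, p ≠ y → p ∉ A → p ∉ B → p ∉ O → z s(p, q) = 0 := by
    intro a b c z z' h h'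
    refine ⟨z + z', by rw [bd_add, h.1, h'.1, add_zero], fun u => ?_, fun p q e1 e2 e3 e4 => ?_⟩
    · rw [Pi.add_apply, h.2.1, h'.2.1, add_add_add_comm, CharTwo.add_self_eq_zero, add_zero]
    · rw [Pi.add_apply, h.2.2 p q e1 e2 e3 e4, h'.2.2 p q e1 e2 e3 e4, add_zero]
  have hpair : ∀ a ∈ A ∪ B, ∀ b ∈ A ∪ B, ∃ z : Sym2 T → ZMod 2, bd Γ z = 0 ∧
      (∀ u, z s(y, u) = (if u = a then 1 else 0) + (if u = b then 1 else 0)) ∧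
      ∀ p q, p ≠ y → p ∉ A → p ∉ B → p ∉ O → z s(p, q) = 0 := by
    obtain ⟨a₀, ha₀⟩ := hA
    obtain ⟨b₀, hb₀⟩ := hB
    intro a ha b hb
    rcases mem_union.1 ha with ha | ha <;> rcases mem_union.1 hb with hb | hb
    · obtain ⟨z, hz⟩ := hsq a ha b₀ hb₀
      obtain ⟨z', hz'⟩ := hsq b hb b₀ hb₀
      exact hadd a b b₀ z z' hz hz'
    · exact hsq a ha b hb
    · obtain ⟨z, h1, h2, h3⟩ := hsq b hb a ha
      exact ⟨z, h1, fun u => by rw [h2, add_comm], h3⟩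
    · obtain ⟨z, h1, h2, h3⟩ := hsq a₀ ha₀ a ha
      obtain ⟨z', h1', h2', h3'⟩ := hsq a₀ ha₀ b hb
      exact hadd a b a₀ z z' ⟨h1, fun u => by rw [h2, add_comm], h3⟩
        ⟨h1', fun u => by rw [h2', add_comm], h3'⟩
  by_cases hex : ∃ a ∈ A ∪ B, ∃ b ∈ A ∪ B, a ≠ b ∧ x s(y, a) = x s(y, b)
  · obtain ⟨a, ha, b, hb, hab, hx⟩ := hex
    obtain ⟨z, h1, h2, h3⟩ := hpair a ha b hb
    refine ⟨z, h1, ?_, h3⟩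
    refine sum_wt_flip_ne (nbrs Γ y) (fun u => x s(y, u)) (fun u => (x + z) s(y, u))
      (hN ▸ mem_insert_of_mem ha) (hN ▸ mem_insert_of_mem hb) hab hx fun u => ?_
    rw [Pi.add_apply, h2]
    congr!
  · -- The weights on the edges to `A ∪ B` are distinct, so the color is at most `2 + (1 + 2)`.
    exfalso
    push Not at hex
    have hinj : Set.InjOn (fun u => x s(y, u)) (A ∪ B : Finset T) := by
      intro a ha b hb hx
      by_contra hab
      exact hex a ha b hb hab hx
    have h3 : ∑ u ∈ A ∪ B, wt (x s(y, u)) ≤ 3 := by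
      rw [← sum_image (g := fun u => x s(y, u)) (f := wt) hinj]
      exact (sum_le_sum_of_subset (subset_univ _)).trans (by decide)
    have : col Γ x y = wt (x s(y, v)) + ∑ u ∈ A ∪ B, wt (x s(y, u)) := by
      rw [col, hN, sum_insert hv]
    have := wt_le (x s(y, v))
    omega

/-- A weighting whose only possible conflicts are at `v` can be repaired one neighbor of `v` at a
time. The predicate `P` collects what the repairs preserve. -/
lemma admitsVCEW_two_of_flips (P : (Sym2 T → ZMod 2) → Prop) (v : T)
    (hpar : ∀ x, P x → ∀ p q, Γ.Adj p q → p ≠ v → q ≠ v → bd Γ x p ≠ bd Γ x q)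
    (hflip : ∀ x, P x → ∀ y, Γ.Adj v y → col Γ x y = col Γ x v → ∃ z, P (x + z) ∧
      col Γ (x + z) v = col Γ x v ∧ col Γ (x + z) y ≠ col Γ x y ∧
      ∀ y', Γ.Adj v y' → y' ≠ y → col Γ (x + z) y' = col Γ x y')
    {x₀ : Sym2 T → ZMod 2} (h₀ : P x₀) : AdmitsVCEW Γ 2 := by
  classical
  obtain ⟨n, hn⟩ : ∃ n, #{y | Γ.Adj v y ∧ col Γ x₀ y = col Γ x₀ v} = n := ⟨_, rfl⟩
  induction n using Nat.strong_induction_on generalizing x₀ with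
  | _ n ih =>
  by_cases hbad : ∃ y, Γ.Adj v y ∧ col Γ x₀ y = col Γ x₀ v
  · obtain ⟨y, hy, hc⟩ := hbad
    obtain ⟨z, hPz, hzv, hzy, hz⟩ := hflip x₀ h₀ y hy hc
    refine ih _ ?_ hPz rfl
    rw [← hn]
    apply card_lt_card
    refine ssubset_iff_of_subset ?_ |>.2 ⟨y, by simp [hy, hc], by simp [hzv, ← hc, hzy]⟩
    intro y'
    simp only [mem_filter, mem_univ, true_and]
    rintro ⟨h1, h2⟩
    refine ⟨h1, ?_⟩
    have hne : y' ≠ y := by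
      rintro rfl
      rw [hzv, ← hc] at h2
      exact hzy h2
    rw [← hz y' h1 hne, h2, hzv]
  · push Not at hbad
    refine admitsVCEW_two_of_col x₀ fun p q hpq => ?_
    by_cases hp : p = v
    · subst hp
      exact (hbad q hpq).symm
    by_cases hq : q = v
    · subst hq
      exact hbad p hpq.symm
    intro h
    apply hpar x₀ h₀ p q hpq hp hq
    rw [← col_cast, ← col_cast, h]

end Flips

/-! ### Flips in cartesian products -/

section BoxProd

variable {V W : Type*} [Fintype V] [Fintype W] {G : SimpleGraph V} {H : SimpleGraph W}

lemma card_nbrs_boxProd (a : V) (b : W) :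
    #(nbrs (G □ H) (a, b)) = #(nbrs G a) + #(nbrs H b) := by
  classical
  have : nbrs (G □ H) (a, b) = (nbrs G a).image (fun a' => (a', b)) ∪
      (nbrs H b).image (fun b' => (a, b')) := by
    ext ⟨a', b'⟩
    simp only [mem_nbrs, boxProd_adj, mem_union, mem_image, Prod.mk.injEq]
    grind
  rw [this, card_union_of_disjoint, card_image_of_injective, card_image_of_injective]
  · exact fun b₁ b₂ h => (Prod.mk.inj h).2
  · exact fun a₁ a₂ h => (Prod.mk.inj h).1
  · rw [Finset.disjoint_left]
    simp only [mem_image, mem_nbrs, not_exists, not_and, forall_exists_index, and_imp]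
    rintro _ a' ha rfl b' hb h
    exact hb.ne (Prod.mk.inj h).2.symm

/-- Flipping at a neighbor `(a, h)` of `(g, h)` in a product of triangle-free graphs, along 4-cycles
that avoid `(g, h)` and its other neighbors. -/
lemma exists_flip_boxProd_left {g a a' : V} {h : W} (x : Sym2 (V × W) → ZMod 2)
    (hga : G.Adj g a) (haa' : G.Adj a a') (ha' : a' ≠ g) (hH : (nbrs H h).Nonempty)
    (htri : ∀ c, G.Adj g c → ¬ G.Adj a c) (hcol : 5 < col (G □ H) x (a, h)) :
    ∃ z : Sym2 (V × W) → ZMod 2, bd (G □ H) z = 0 ∧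
      col (G □ H) (x + z) (a, h) ≠ col (G □ H) x (a, h) ∧ (∀ q, z s((g, h), q) = 0) ∧
      (∀ c, G.Adj g c → c ≠ a → ∀ q, z s((c, h), q) = 0) ∧
      ∀ b q, H.Adj h b → z s((g, b), q) = 0 := by
  classical
  have hN : nbrs (G □ H) (a, h) = insert (g, h) (((nbrs G a).erase g).image (fun c => (c, h)) ∪
      (nbrs H h).image (fun b => (a, b))) := by
    ext ⟨c, b⟩
    simp only [mem_nbrs, boxProd_adj, mem_insert, mem_union, mem_image, mem_erase, Prod.mk.injEq]
    grind [hga.symm]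
  have hv : (g, h) ∉ ((nbrs G a).erase g).image (fun c => (c, h)) ∪
      (nbrs H h).image (fun b => (a, b)) := by
    simp only [mem_union, mem_image, mem_erase, mem_nbrs, Prod.mk.injEq]
    grind [hga.ne]
  have hA : (((nbrs G a).erase g).image (fun c => (c, h))).Nonempty :=
    ⟨(a', h), by simp [haa', ha']⟩
  obtain ⟨z, h1, h2, h3⟩ := exists_flip (O := {p | p.1 ≠ a ∧ p.1 ≠ g ∧ p.2 ≠ h}) x hN hv hA
    (hH.image _) (by
      simp only [mem_image, mem_erase, mem_nbrs]
      rintro _ ⟨c, ⟨hc1, hc2⟩, rfl⟩ _ ⟨b, hb, rfl⟩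
      exact ⟨(c, b), ⟨hc2.ne.symm, hc1, hb.ne.symm⟩, by simpa [boxProd_adj] using hb,
        by simpa [boxProd_adj] using hc2⟩) (by simp) hcol
  refine ⟨z, h1, h2, fun q => h3 _ _ ?_ ?_ ?_ ?_, fun c hc hca q => h3 _ _ ?_ ?_ ?_ ?_,
    fun b q hb => h3 _ _ ?_ ?_ ?_ ?_⟩
  all_goals
    simp only [mem_image, mem_erase, mem_nbrs, Set.mem_ofPred_eq, Prod.mk.injEq, ne_eq]
    grind [hga.ne]

lemma exists_flip_boxProd_right {g : V} {h b b' : W} (x : Sym2 (V × W) → ZMod 2)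
    (hhb : H.Adj h b) (hbb' : H.Adj b b') (hb' : b' ≠ h) (hG : (nbrs G g).Nonempty)
    (htri : ∀ c, H.Adj h c → ¬ H.Adj b c) (hcol : 5 < col (G □ H) x (g, b)) :
    ∃ z : Sym2 (V × W) → ZMod 2, bd (G □ H) z = 0 ∧
      col (G □ H) (x + z) (g, b) ≠ col (G □ H) x (g, b) ∧ (∀ q, z s((g, h), q) = 0) ∧
      (∀ c, H.Adj h c → c ≠ b → ∀ q, z s((g, c), q) = 0) ∧
      ∀ a q, G.Adj g a → z s((a, h), q) = 0 := by
  classical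
  have hN : nbrs (G □ H) (g, b) = insert (g, h) (((nbrs H b).erase h).image (fun c => (g, c)) ∪
      (nbrs G g).image (fun a => (a, b))) := by
    ext ⟨c, d⟩
    simp only [mem_nbrs, boxProd_adj, mem_insert, mem_union, mem_image, mem_erase, Prod.mk.injEq]
    grind [hhb.symm]
  have hv : (g, h) ∉ ((nbrs H b).erase h).image (fun c => (g, c)) ∪
      (nbrs G g).image (fun a => (a, b)) := by
    simp only [mem_union, mem_image, mem_erase, mem_nbrs, Prod.mk.injEq]
    grind [hhb.ne]
  have hA : (((nbrs H b).erase h).image (fun c => (g, c))).Nonempty :=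
    ⟨(g, b'), by simp [hbb', hb']⟩
  obtain ⟨z, h1, h2, h3⟩ := exists_flip (O := {p | p.2 ≠ b ∧ p.2 ≠ h ∧ p.1 ≠ g}) x hN hv hA
    (hG.image _) (by
      simp only [mem_image, mem_erase, mem_nbrs]
      rintro _ ⟨c, ⟨hc1, hc2⟩, rfl⟩ _ ⟨a, ha, rfl⟩
      exact ⟨(a, c), ⟨hc2.ne.symm, hc1, ha.ne.symm⟩, by simpa [boxProd_adj] using ha,
        by simpa [boxProd_adj] using hc2⟩) (by simp) hcol
  refine ⟨z, h1, h2, fun q => h3 _ _ ?_ ?_ ?_ ?_, fun c hc hca q => h3 _ _ ?_ ?_ ?_ ?_,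
    fun a q ha => h3 _ _ ?_ ?_ ?_ ?_⟩
  all_goals
    simp only [mem_image, mem_erase, mem_nbrs, Set.mem_ofPred_eq, Prod.mk.injEq, ne_eq]
    grind [hhb.ne]

/-- A weighting `x₀` with the parities of a 2-coloring off `(g, h)`, and weight 2 at every edge of
`(g, h)`, can be repaired. Neighbors of `(g, h)` at which no flip is available have too small a
color to conflict with it; for `deg g = 1` the neighbor `(a, h)` has the same degree as `(g, h)` and
needs an edge of weight 1, which all the flips preserve. -/
lemma admitsVCEW_two_of_parity {side : V × W → ZMod 2}
    (hside : ∀ p q, (G □ H).Adj p q → side p ≠ side q) {g : V} {h : W}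
    (hg : 1 ≤ #(nbrs G g)) (hh : 2 ≤ #(nbrs H h)) {x₀ : Sym2 (V × W) → ZMod 2}
    (hbd : ∀ p, p ≠ (g, h) → bd (G □ H) x₀ p = side p) (hv : ∀ q, x₀ s((g, h), q) = 0)
    (hleaf : #(nbrs G g) = 1 → ∀ a, G.Adj g a → (∀ a', G.Adj a a' → a' = g) ∧
      ∃ q, (G □ H).Adj (a, h) q ∧ x₀ s((a, h), q) ≠ 0) :
    AdmitsVCEW (G □ H) 2 := by
  have h3 : ∀ r s t : ZMod 2, r ≠ s → r ≠ t → s ≠ t → False := by decide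
  have htriG : ∀ a, G.Adj g a → ∀ c, G.Adj g c → ¬ G.Adj a c := fun a ha c hc hac =>
    h3 (side (g, h)) (side (a, h)) (side (c, h)) (hside _ _ (by simpa [boxProd_adj] using ha))
      (hside _ _ (by simpa [boxProd_adj] using hc)) (hside _ _ (by simpa [boxProd_adj] using hac))
  have htriH : ∀ a, H.Adj h a → ∀ c, H.Adj h c → ¬ H.Adj a c := fun a ha c hc hac =>
    h3 (side (g, h)) (side (g, a)) (side (g, c)) (hside _ _ (by simpa [boxProd_adj] using ha))
      (hside _ _ (by simpa [boxProd_adj] using hc)) (hside _ _ (by simpa [boxProd_adj] using hac))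
  have hneG : (nbrs G g).Nonempty := card_pos.1 (by omega)
  have hneH : (nbrs H h).Nonempty := card_pos.1 (by omega)
  refine admitsVCEW_two_of_flips (fun x => (∀ p, p ≠ (g, h) → bd (G □ H) x p = side p) ∧
    (∀ q, x s((g, h), q) = 0) ∧
    (#(nbrs G g) = 1 → ∀ a, G.Adj g a → ∀ q, x s((a, h), q) = x₀ s((a, h), q)))
    (g, h) ?_ ?_ ⟨hbd, hv, fun _ _ _ _ => rfl⟩
  · rintro x ⟨hx, -⟩ p q hpq hp hq
    rw [hx p hp, hx q hq]
    exact hside p q hpq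
  rintro x ⟨hx, hxv, hxl⟩ ⟨a, b⟩ hadj hc
  have hcv : col (G □ H) x (g, h) = 2 * (#(nbrs G g) + #(nbrs H h)) := by
    rw [col_eq_of_forall hxv, card_nbrs_boxProd]
  have hle := col_le (Γ := G □ H) x (a, b)
  rw [card_nbrs_boxProd] at hle
  rw [boxProd_adj] at hadj
  simp only at hadj
  rcases hadj with ⟨hga, rfl⟩ | ⟨hhb, rfl⟩
  · by_cases hex : ∃ a', G.Adj a a' ∧ a' ≠ g
    · obtain ⟨a', haa', ha'⟩ := hex
      obtain ⟨z, z1, z2, z3, z4, z5⟩ := exists_flip_boxProd_left x hga haa' ha'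
        hneH (htriG a hga) (by rw [hc, hcv]; omega)
      refine ⟨z, ⟨fun p hp => ?_, fun q => ?_, fun hdeg => ?_⟩, col_congr z3, z2, ?_⟩
      · rw [bd_add, z1, add_zero, hx p hp]
      · rw [Pi.add_apply, hxv, z3, add_zero]
      · exact absurd ((hleaf hdeg a hga).1 a' haa') ha'
      · rintro ⟨c, d⟩ hcd hne
        rw [boxProd_adj] at hcd
        simp only at hcd
        rcases hcd with ⟨hgc, rfl⟩ | ⟨hhd, rfl⟩
        · exact col_congr (z4 c hgc fun hca => hne (by rw [hca]))
        · exact col_congr fun q => z5 d q hhd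
    · exfalso
      push Not at hex
      have hca : #(nbrs G a) ≤ 1 := by
        rw [card_le_one]
        intro c hc d hd
        rw [hex c (by simpa using hc), hex d (by simpa using hd)]
      have hdeg : #(nbrs G g) = 1 := by omega
      obtain ⟨-, q, hq, hxq⟩ := hleaf hdeg a hga
      rw [← hxl hdeg a hga] at hxq
      have := col_lt hq hxq
      rw [card_nbrs_boxProd] at this
      omega
  · by_cases hex : ∃ b', H.Adj b b' ∧ b' ≠ h
    · obtain ⟨b', hbb', hb'⟩ := hex
      obtain ⟨z, z1, z2, z3, z4, z5⟩ := exists_flip_boxProd_right x hhb hbb' hb'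
        hneG (htriH b hhb) (by rw [hc, hcv]; omega)
      refine ⟨z, ⟨fun p hp => ?_, fun q => ?_, fun hdeg c hgc q => ?_⟩, col_congr z3, z2, ?_⟩
      · rw [bd_add, z1, add_zero, hx p hp]
      · rw [Pi.add_apply, hxv, z3, add_zero]
      · rw [Pi.add_apply, z5 c q hgc, add_zero, hxl hdeg c hgc]
      · rintro ⟨c, d⟩ hcd hne
        rw [boxProd_adj] at hcd
        simp only at hcd
        rcases hcd with ⟨hgc, rfl⟩ | ⟨hhd, rfl⟩
        · exact col_congr fun q => z5 c q hgc
        · exact col_congr (z4 d hhd fun hdb => hne (by rw [hdb]))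
    · exfalso
      push Not at hex
      have hcb : #(nbrs H b) ≤ 1 := by
        rw [card_le_one]
        intro c hc d hd
        rw [hex c (by simpa using hc), hex d (by simpa using hd)]
      omega

end BoxProd

/-! ### Bipartite graphs and parities of their parts -/

section Parity

lemma zmod_two_eq_one {a : ZMod 2} : a ≠ 0 → a = 1 := by
  revert a; decide

/-- The 2-coloring of a bipartite graph with values in `ZMod 2`, the color 1 marking the part whose
vertices are meant to get odd induced colors. -/
lemma exists_side {V : Type*} {G : SimpleGraph V} (h : G.IsBipartite) :
    ∃ s : V → ZMod 2, ∀ p q, G.Adj p q → s p ≠ s q := by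
  obtain ⟨c⟩ := h
  exact ⟨fun v => c v, fun p q hpq => c.valid hpq⟩

lemma isBipartite_of_side {V : Type*} {G : SimpleGraph V} {s : V → ZMod 2}
    (h : ∀ p q, G.Adj p q → s p ≠ s q) : G.IsBipartite := by
  have := (Coloring.mk s fun {p q} hpq => h p q hpq : G.Coloring (ZMod 2)).colorable
  simpa using this

lemma boxProd_side {V W : Type*} {G : SimpleGraph V} {H : SimpleGraph W} {s : V → ZMod 2}
    {t : W → ZMod 2} (hs : ∀ p q, G.Adj p q → s p ≠ s q) (ht : ∀ p q, H.Adj p q → t p ≠ t q)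
    (p q : V × W) (h : (G □ H).Adj p q) : s p.1 + t p.2 ≠ s q.1 + t q.2 := by
  rw [boxProd_adj] at h
  rcases h with ⟨h1, h2⟩ | ⟨h1, h2⟩
  · rw [h2]
    simpa using hs _ _ h1
  · rw [h2]
    simpa using ht _ _ h1

/-- If one part of a connected bipartite graph has even size, the vertices of this part can be given
odd colors and all the others even colors. -/
lemma admitsVCEW_two_of_sum_side_eq_zero {T : Type*} [Fintype T] {Γ : SimpleGraph T}
    (hΓ : Γ.Connected) {side : T → ZMod 2} (hside : ∀ p q, Γ.Adj p q → side p ≠ side q)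
    (hsum : ∑ p, side p = 0) : AdmitsVCEW Γ 2 := by
  obtain ⟨r⟩ := hΓ.nonempty
  obtain ⟨z, -, hz⟩ := exists_bd_eq le_rfl side r (fun p _ => hΓ.preconnected p r) hsum
  refine admitsVCEW_two_of_col z fun p q hpq h => hside p q hpq ?_
  rw [← hz, ← col_cast, ← col_cast, h]

lemma sum_side_boxProd {V W : Type*} [Fintype V] [Fintype W] (s : V → ZMod 2) (t : W → ZMod 2) :
    ∑ p : V × W, (s p.1 + t p.2) =
      Fintype.card W * ∑ a, s a + Fintype.card V * ∑ b, t b := by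
  rw [Fintype.sum_prod_type]
  simp [sum_add_distrib, mul_sum]

lemma eq_or_eq_of_connected {V : Type*} {G : SimpleGraph V} (hG : G.Connected) {g g' : V}
    (h1 : ∀ a, G.Adj g a → a = g') (h2 : ∀ a, G.Adj g' a → a = g) (a : V) : a = g ∨ a = g' := by
  obtain ⟨w⟩ := hG.preconnected a g
  induction w with
  | nil => exact Or.inl rfl
  | cons hab w ih =>
    rcases ih h1 h2 with rfl | rfl
    · exact Or.inr (h1 _ hab.symm)
    · exact Or.inl (h2 _ hab.symm)

end Parity

/-! ### Weightings of products with two odd parts -/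

section Existence

lemma reachable_mk_left {V W : Type*} {G : SimpleGraph V}
    {A : SimpleGraph (V × W)} (hG : G.Connected) (b : W)
    (hA : ∀ a a', G.Adj a a' → A.Adj (a, b) (a', b)) (a a' : V) :
    A.Reachable (a, b) (a', b) :=
  (hG.preconnected a a').map ⟨fun a => (a, b), fun {a a'} h => hA a a' h⟩

lemma reachable_mk_right {V W : Type*} {H : SimpleGraph W}
    {A : SimpleGraph (V × W)} (hH : H.Connected) (a : V)
    (hA : ∀ b b', H.Adj b b' → A.Adj (a, b) (a, b')) (b b' : W) :
    A.Reachable (a, b) (a, b') :=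
  (hH.preconnected b b').map ⟨fun b => (a, b), fun {b b'} h => hA b b' h⟩

variable {V W : Type*} [Fintype V] [Fintype W] {G : SimpleGraph V} {H : SimpleGraph W}

lemma sum_add_single {T : Type*} [Fintype T] [DecidableEq T] {f : T → ZMod 2}
    (hf : ∑ p, f p = 1) (v : T) : ∑ p, (f + Pi.single v 1 : T → ZMod 2) p = 0 := by
  simp only [Pi.add_apply, sum_add_distrib, hf, sum_pi_single', mem_univ, if_true]
  decide

/-- A product of nontrivial connected graphs has no cut vertex, so that all parities off a vertex
`(g, h)` of an odd part can be prescribed while its edges keep weight 2. -/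
lemma exists_parity_boxProd (hG : G.Connected) (hH : H.Connected) {side : V × W → ZMod 2} {g : V}
    {h : W} {a₁ : V} {b₁ : W} (ha₁ : a₁ ≠ g) (hb₁ : b₁ ≠ h) (hsum : ∑ p, side p = 1)
    (hv : side (g, h) = 1) :
    ∃ x : Sym2 (V × W) → ZMod 2, (∀ p, p ≠ (g, h) → bd (G □ H) x p = side p) ∧
      ∀ q, x s((g, h), q) = 0 := by
  classical
  have hA : (G □ H).deleteIncidenceSet (g, h) ≤ G □ H := deleteIncidenceSet_le _ _
  have hrow : ∀ c ≠ g, ∀ d d', ((G □ H).deleteIncidenceSet (g, h)).Reachable (c, d) (c, d') :=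
    fun c hc => reachable_mk_right hH c fun d d' hd => by
      simp [deleteIncidenceSet_adj, hd, hc]
  have hcolumn : ∀ d ≠ h, ∀ c c', ((G □ H).deleteIncidenceSet (g, h)).Reachable (c, d) (c', d) :=
    fun d hd => reachable_mk_left hG d fun c c' hc => by
      simp [deleteIncidenceSet_adj, hc, hd]
  have hreach : ∀ p, (side + Pi.single (g, h) 1 : V × W → ZMod 2) p ≠ 0 →
      ((G □ H).deleteIncidenceSet (g, h)).Reachable p (a₁, b₁) := by
    rintro ⟨a, b⟩ hp
    have hne : (a, b) ≠ (g, h) := by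
      intro e
      rw [e] at hp
      exact hp (by simp only [Pi.add_apply, hv, Pi.single_eq_same]; decide)
    by_cases ha : a = g
    · have hb : b ≠ h := fun e => hne (by rw [ha, e])
      exact (hcolumn b hb a a₁).trans (hrow a₁ ha₁ b b₁)
    · exact (hrow a ha b b₁).trans (hcolumn b₁ hb₁ a a₁)
  obtain ⟨z, hz, hbd⟩ := exists_bd_eq hA _ (a₁, b₁) hreach (sum_add_single hsum _)
  refine ⟨z, fun p hp => ?_, fun q => hz _ _ ?_⟩
  · simp [hbd, hp]
  · simp [deleteIncidenceSet_adj]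

lemma admitsVCEW_two_of_two_le (hG : G.Connected) (hH : H.Connected) {g : V} {h : W}
    (hg : 2 ≤ #(nbrs G g)) (hh : 2 ≤ #(nbrs H h))
    (hodd : ∀ v, ∃ side : V × W → ZMod 2, (∀ p q, (G □ H).Adj p q → side p ≠ side q) ∧
      ∑ p, side p = 1 ∧ side v = 1) :
    AdmitsVCEW (G □ H) 2 := by
  obtain ⟨side, hside, hsum, hv⟩ := hodd (g, h)
  obtain ⟨a₁, ha₁⟩ : (nbrs G g).Nonempty := card_pos.1 (by omega)
  obtain ⟨b₁, hb₁⟩ : (nbrs H h).Nonempty := card_pos.1 (by omega)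
  obtain ⟨x, hx, hx0⟩ := exists_parity_boxProd hG hH (mem_nbrs.1 ha₁).ne.symm
    (mem_nbrs.1 hb₁).ne.symm hsum hv
  exact admitsVCEW_two_of_parity hside (by omega) hh hx hx0 (fun h => by omega)

/-- The case where the first factor is a single edge `g g'`. If a non-cut vertex `u` of `H` has two
neighbors, then `(g, u)` and one further edge at `(g', u)` can be deleted without disconnecting the
rest, and this edge is given weight 1. If `u` is a leaf with neighbor `h`, then the opposite
parities of `(g, u)` and `(g', u)` force weight 1 on the edge from `(g', h)` to `(g', u)`. -/
lemma admitsVCEW_two_of_edge (hG : G.Connected) (hH : H.Connected) {g g' : V}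
    (hgg' : G.Adj g g') (hV : ∀ a, a = g ∨ a = g') {k : W} (hk : 2 ≤ #(nbrs H k))
    (hodd : ∀ v, ∃ side : V × W → ZMod 2, (∀ p q, (G □ H).Adj p q → side p ≠ side q) ∧
      ∑ p, side p = 1 ∧ side v = 1) :
    AdmitsVCEW (G □ H) 2 := by
  classical
  have hne := hgg'.ne
  have hadj : ∀ a, G.Adj g a → a = g' := fun a ha => (hV a).resolve_left ha.ne.symm
  have hadj' : ∀ a, G.Adj g' a → a = g := fun a ha => (hV a).resolve_right ha.ne.symm
  have hdg : 1 ≤ #(nbrs G g) := card_pos.2 ⟨g', by simpa using hgg'⟩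
  have : Nontrivial W := by
    obtain ⟨b, hb⟩ : (nbrs H k).Nonempty := card_pos.1 (by omega)
    exact ⟨k, b, (mem_nbrs.1 hb).ne⟩
  obtain ⟨u, hu⟩ := hH.exists_connected_induce_compl_singleton_of_finite_nontrivial
  obtain ⟨h, hh⟩ : ∃ h, H.Adj u h := hH.preconnected.exists_adj_of_nontrivial u
  by_cases hdu : 2 ≤ #(nbrs H u)
  · obtain ⟨side, hside, hsum, hv⟩ := hodd (g, u)
    obtain ⟨h₂, hh₂, hne₂⟩ := exists_mem_ne hdu h
    rw [mem_nbrs] at hh₂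
    set A := ((G □ H).deleteIncidenceSet (g, u)).deleteEdges {s((g', u), (g', h))} with hAdef
    have hA : A ≤ G □ H := (deleteEdges_le _).trans (deleteIncidenceSet_le _ _)
    have hAadj : ∀ p q, A.Adj p q ↔ ((G □ H).Adj p q ∧ p ≠ (g, u) ∧ q ≠ (g, u)) ∧
        s(p, q) ≠ s((g', u), (g', h)) := by
      intro p q
      simp [hAdef, deleteEdges_adj, deleteIncidenceSet_adj]
    have he : (G □ H).Adj (g', u) (g', h) := by simpa [boxProd_adj] using hh
    have hrow : ∀ b ≠ u, A.Reachable (g', b) (g', h) := by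
      intro b hb
      exact (hu.preconnected ⟨b, hb⟩ ⟨h, hh.ne.symm⟩).map
        ⟨fun c : ({u}ᶜ : Set W) => (g', (c : W)), fun {c d} hcd => by
          have hc : (c : W) ≠ u := c.2
          have hd : (d : W) ≠ u := d.2
          have : H.Adj c d := hcd
          simp [hAadj, hc, hd, this]⟩
    have hcolumn : ∀ b ≠ u, ∀ a a', A.Reachable (a, b) (a', b) :=
      fun b hb => reachable_mk_left hG b fun a a' ha => by
        simp [hAadj, ha, hb]
    have hv0 : (side + Pi.single (g, u) 1 + (Pi.single (g', u) 1 + Pi.single (g', h) 1) :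
        V × W → ZMod 2) (g, u) = 0 := by
      simp only [Pi.add_apply, hv, Pi.single_apply, Prod.mk.injEq, hne, false_and, if_false,
        if_true]
      decide
    -- The chain `z` avoids the deleted edge; the two last terms make up for adding that edge to `z`.
    obtain ⟨z, hz, hbd⟩ := exists_bd_eq hA
      (side + Pi.single (g, u) 1 + (Pi.single (g', u) 1 + Pi.single (g', h) 1)) (g', h) (by
        rintro ⟨a, b⟩ hp
        have hp' : (a, b) ≠ (g, u) := by
          intro e
          rw [e] at hp
          exact hp hv0
        by_cases hb : b = u
        · have ha : a = g' := (hV a).resolve_left fun e => hp' (by rw [e, hb])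
          have : A.Adj (g', u) (g', h₂) := by
            simp [hAadj, hh₂, hne.symm, hne₂, hh₂.ne.symm]
          rw [ha, hb]
          exact this.reachable.trans (hrow h₂ hh₂.ne.symm)
        · exact (hcolumn b hb a g').trans (hrow b hb)) (by
        have := sum_add_single hsum (g, u)
        simp only [Pi.add_apply, sum_add_distrib, sum_pi_single'] at this ⊢
        rw [this]
        simp only [mem_univ, if_true, zero_add]
        decide)
    refine admitsVCEW_two_of_parity (g := g) (h := u) hside hdg hdu
      (x₀ := z + Pi.single s((g', u), (g', h)) 1) ?_ ?_ ?_
    · intro p hp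
      rw [bd_add, hbd, bd_single he, add_assoc, add_self_fun]
      simp [hp]
    · intro q
      have h1 : s((g, u), q) ≠ s((g', u), (g', h)) := by simp [hne]
      rw [Pi.add_apply, Pi.single_eq_of_ne h1, hz _ _ (by simp [hAadj]), add_zero]
    · intro _ a ha
      obtain rfl := hadj a ha
      refine ⟨hadj', (a, h), he, ?_⟩
      rw [Pi.add_apply, Pi.single_eq_same, hz _ _ (by simp [hAadj])]
      decide
  · have hleaf : ∀ b, H.Adj u b → b = h := by
      have : #(nbrs H u) ≤ 1 := by omega
      intro b hb
      exact card_le_one.1 this b (by simpa using hb) h (by simpa using hh)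
    have hdh : 2 ≤ #(nbrs H h) := by
      by_contra hcon
      have h1 : #(nbrs H h) ≤ 1 := by omega
      rcases eq_or_eq_of_connected hH hleaf (fun b hb => card_le_one.1 h1 b (by simpa using hb) u
        (by simpa using hh.symm)) k with rfl | rfl <;> omega
    obtain ⟨side, hside, hsum, hv⟩ := hodd (g, h)
    obtain ⟨x, hx, hx0⟩ := exists_parity_boxProd hG hH hne.symm hh.ne hsum hv
    refine admitsVCEW_two_of_parity hside hdg hdh hx hx0 fun _ a ha => ?_
    obtain rfl := hadj a ha
    refine ⟨hadj', (a, u), by simpa [boxProd_adj] using hh.symm, fun h0 => ?_⟩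
    have e1 := hx (g, u) (by simp [hh.ne])
    have e2 := hx (a, u) (by simp [hh.ne])
    have n1 : nbrs (G □ H) (g, u) = {(g, h), (a, u)} := by
      ext ⟨c, d⟩
      simp only [mem_nbrs, boxProd_adj, mem_insert, mem_singleton, Prod.mk.injEq]
      grind
    have n2 : nbrs (G □ H) (a, u) = {(a, h), (g, u)} := by
      ext ⟨c, d⟩
      simp only [mem_nbrs, boxProd_adj, mem_insert, mem_singleton, Prod.mk.injEq]
      grind [hgg'.symm]
    rw [bd, n1, sum_pair (by simp [hne]), Sym2.eq_swap, hx0, zero_add] at e1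
    rw [bd, n2, sum_pair (by simp [hne.symm]), Sym2.eq_swap, h0, zero_add, Sym2.eq_swap, e1] at e2
    exact hside (g, u) (a, u) (by simpa [boxProd_adj] using hgg') e2

end Existence

/-! ### Invariance under isomorphism -/

section Transport

lemma AdmitsVCEW.of_iso {V V' : Type*} [Fintype V] [Fintype V'] {G : SimpleGraph V}
    {G' : SimpleGraph V'} (φ : G ≃g G') {k : ℕ} (h : AdmitsVCEW G k) : AdmitsVCEW G' k := by
  classical
  obtain ⟨w, hw, hc⟩ := h
  have key : ∀ v, inducedColoring (fun e => w (φ.symm.mapEdgeSet e)) v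
      = inducedColoring w (φ.symm v) := by
    intro v
    unfold inducedColoring
    refine sum_equiv φ.symm.mapEdgeSet (fun e => ?_) fun e _ => rfl
    obtain ⟨e, he⟩ := e
    induction e with
    | _ a b => simp [Iso.mapEdgeSet, Hom.mapEdgeSet]
  refine ⟨fun e => w (φ.symm.mapEdgeSet e), fun e => hw _, fun u v huv => ?_⟩
  rw [key, key]
  exact hc _ _ (φ.symm.map_rel_iff.2 huv)

lemma mu_eq_of_iso {V V' : Type*} [Fintype V] [Fintype V'] {G : SimpleGraph V}
    {G' : SimpleGraph V'} (φ : G ≃g G') : mu G = mu G' := by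
  have : ∀ k, AdmitsVCEW G k ↔ AdmitsVCEW G' k := fun k =>
    ⟨AdmitsVCEW.of_iso φ, AdmitsVCEW.of_iso φ.symm⟩
  simp only [mu, this]

end Transport

/-! ### Products of connected bipartite graphs -/

section Products

variable {V W : Type*} [Fintype V] [Fintype W] {G : SimpleGraph V} {H : SimpleGraph W}

lemma exists_two_le_or_edge [Nontrivial V] (hG : G.Connected) :
    (∃ g, 2 ≤ #(nbrs G g)) ∨ ∃ g g', G.Adj g g' ∧ ∀ a, a = g ∨ a = g' := by
  by_cases h : ∃ g, 2 ≤ #(nbrs G g)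
  · exact Or.inl h
  · push Not at h
    have h1 : ∀ g a b, G.Adj g a → G.Adj g b → a = b := fun g a b ha hb =>
      card_le_one.1 (Nat.le_of_lt_succ (h g)) a (by simpa using ha) b (by simpa using hb)
    obtain ⟨g⟩ := hG.nonempty
    obtain ⟨g', hgg'⟩ := hG.preconnected.exists_adj_of_nontrivial g
    exact Or.inr ⟨g, g', hgg', eq_or_eq_of_connected hG (fun a ha => h1 g a g' ha hgg')
      fun a ha => h1 g' a g ha hgg'.symm⟩

lemma card_eq_two {g g' : V} (hgg' : g ≠ g') (h : ∀ a, a = g ∨ a = g') : Fintype.card V = 2 := by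
  classical
  rw [← card_univ, ← card_pair hgg']
  congr 1
  ext a
  simpa using h a

theorem admitsVCEW_two_boxProd [Nontrivial V] [Nontrivial W] (hG : G.Connected)
    (hH : H.Connected) (hG' : G.IsBipartite) (hH' : H.IsBipartite) : AdmitsVCEW (G □ H) 2 := by
  obtain ⟨s, hs⟩ := exists_side hG'
  obtain ⟨t, ht⟩ := exists_side hH'
  have hst := boxProd_side hs ht
  have hst' : ∀ p q, (G □ H).Adj p q → s p.1 + t p.2 + 1 ≠ s q.1 + t q.2 + 1 :=
    fun p q hpq => by simpa using hst p q hpq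
  -- Either some part is even, or both are odd, and then `v` may be placed in the part marked 1.
  by_cases h0 : ∑ p : V × W, (s p.1 + t p.2) = 0
  · exact admitsVCEW_two_of_sum_side_eq_zero (hG.boxProd hH) hst h0
  by_cases h1 : ∑ p : V × W, (s p.1 + t p.2 + 1) = 0
  · exact admitsVCEW_two_of_sum_side_eq_zero (hG.boxProd hH) hst' h1
  have hodd : ∀ v, ∃ side : V × W → ZMod 2, (∀ p q, (G □ H).Adj p q → side p ≠ side q) ∧
      ∑ p, side p = 1 ∧ side v = 1 := by
    intro v
    by_cases hv : s v.1 + t v.2 = 0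
    · exact ⟨_, hst', zmod_two_eq_one h1, by simp [hv]⟩
    · exact ⟨_, hst, zmod_two_eq_one h0, zmod_two_eq_one hv⟩
  rcases exists_two_le_or_edge hG with ⟨g, hg⟩ | ⟨g, g', hgg', hV⟩
  · rcases exists_two_le_or_edge hH with ⟨h, hh⟩ | ⟨h, h', hhh', hW⟩
    · exact admitsVCEW_two_of_two_le hG hH hg hh hodd
    · refine AdmitsVCEW.of_iso (boxProdComm H G)
        (admitsVCEW_two_of_edge hH hG hhh' hW hg fun v => ?_)
      obtain ⟨side, h1, h2, h3⟩ := hodd v.swap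
      refine ⟨fun p => side p.swap, fun p q hpq => h1 _ _ ?_, ?_, h3⟩
      · rw [boxProd_adj] at hpq ⊢
        exact hpq.symm
      · rw [← h2]
        exact Equiv.sum_comp (Equiv.prodComm W V) side
  · rcases exists_two_le_or_edge hH with ⟨h, hh⟩ | ⟨h, h', hhh', hW⟩
    · exact admitsVCEW_two_of_edge hG hH hgg' hV hh hodd
    · -- The product is a 4-cycle, whose parts have size 2.
      refine absurd ?_ h0
      rw [sum_side_boxProd, card_eq_two hgg'.ne hV, card_eq_two hhh'.ne hW]
      have : ((2 : ℕ) : ZMod 2) = 0 := by decide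
      rw [this, zero_mul, zero_mul, add_zero]

lemma not_admitsVCEW_one_boxProd [Nonempty V] [Nonempty W]
    (h : ¬ AdmitsVCEW G 1 ∨ ¬ AdmitsVCEW H 1) : ¬ AdmitsVCEW (G □ H) 1 := by
  simp only [admitsVCEW_one_iff, not_forall, not_not, exists_prop] at h ⊢
  rcases h with ⟨a, a', ha, hd⟩ | ⟨b, b', hb, hd⟩
  · obtain ⟨b⟩ := ‹Nonempty W›
    exact ⟨(a, b), (a', b), by simpa [boxProd_adj] using ha, by
      rw [card_nbrs_boxProd, card_nbrs_boxProd, hd]⟩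
  · obtain ⟨a⟩ := ‹Nonempty V›
    exact ⟨(a, b), (a, b'), by simpa [boxProd_adj] using hb, by
      rw [card_nbrs_boxProd, card_nbrs_boxProd, hd]⟩

theorem mu_boxProd_eq_two [Nontrivial V] [Nontrivial W] (hG : G.Connected) (hH : H.Connected)
    (hG' : G.IsBipartite) (hH' : H.IsBipartite) (h : ¬ AdmitsVCEW G 1 ∨ ¬ AdmitsVCEW H 1) :
    mu (G □ H) = 2 :=
  mu_eq_two (not_admitsVCEW_one_boxProd h) (admitsVCEW_two_boxProd hG hH hG' hH')

end Products

/-! ### Cycles, paths and cubes -/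

section Families

lemma cycleGraph_connected_of_pos {n : ℕ} (hn : 1 ≤ n) : (cycleGraph n).Connected := by
  obtain ⟨k, rfl⟩ := Nat.exists_eq_add_of_le' hn
  exact cycleGraph_connected

lemma pathGraph_connected_of_pos {n : ℕ} (hn : 1 ≤ n) : (pathGraph n).Connected := by
  obtain ⟨k, rfl⟩ := Nat.exists_eq_add_of_le' hn
  exact pathGraph_connected k

lemma isBipartite_cycleGraph {n : ℕ} (hn : Even n) : (cycleGraph n).IsBipartite := by
  simpa using (cycleGraph.bicoloring_of_even n hn).colorable

lemma isBipartite_pathGraph (n : ℕ) : (pathGraph n).IsBipartite := by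
  simpa using (pathGraph.bicoloring n).colorable

lemma not_admitsVCEW_one_cycleGraph {n : ℕ} (hn : 3 ≤ n) : ¬ AdmitsVCEW (cycleGraph n) 1 := by
  obtain ⟨k, rfl⟩ := Nat.exists_eq_add_of_le' hn
  have hcard : ∀ v, #(nbrs (cycleGraph (k + 3)) v) = 2 := by
    intro v
    rw [← cycleGraph_degree_three_le (v := v), ← card_neighborFinset_eq_degree]
    congr 1
    ext u
    simp
  rw [admitsVCEW_one_iff]
  intro h
  exact h 0 1 (by simp [cycleGraph_adj]) (by rw [hcard, hcard])

lemma not_admitsVCEW_one_pathGraph {n : ℕ} (hn : 2 ≤ n) (hn3 : n ≠ 3) :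
    ¬ AdmitsVCEW (pathGraph n) 1 := by
  rw [admitsVCEW_one_iff]
  intro h
  rcases eq_or_lt_of_le hn with rfl | hn
  · refine h 0 1 (by simp [pathGraph_adj]) ?_
    have e0 : nbrs (pathGraph 2) 0 = {1} := by
      ext a; fin_cases a <;> simp [pathGraph_adj]
    have e1 : nbrs (pathGraph 2) 1 = {0} := by
      ext a; fin_cases a <;> simp [pathGraph_adj]
    rw [e0, e1, card_singleton, card_singleton]
  · have h4 : 4 ≤ n := by omega
    refine h ⟨1, by omega⟩ ⟨2, by omega⟩ (by simp [pathGraph_adj]) ?_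
    have e1 : nbrs (pathGraph n) ⟨1, by omega⟩ = {⟨0, by omega⟩, ⟨2, by omega⟩} := by
      ext a
      simp only [mem_nbrs, pathGraph_adj, mem_insert, mem_singleton, Fin.ext_iff]
      omega
    have e2 : nbrs (pathGraph n) ⟨2, by omega⟩ = {⟨1, by omega⟩, ⟨3, by omega⟩} := by
      ext a
      simp only [mem_nbrs, pathGraph_adj, mem_insert, mem_singleton, Fin.ext_iff]
      omega
    rw [e1, e2, card_pair (by simp), card_pair (by simp)]

/-- Splitting off the first coordinate exhibits `Q_{n+1}` as `K_2 □ Q_n`. -/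
def boxProdCubeIso (n : ℕ) :
    boxProd (completeGraph (Fin 2)) (cubeGraph n) ≃g cubeGraph (n + 1) where
  toEquiv := Fin.consEquiv fun _ => Fin 2
  map_rel_iff' := by
    rintro ⟨a, x⟩ ⟨b, y⟩
    simp only [cubeGraph, boxPower, boxProd_adj, Fin.consEquiv_apply, Fin.exists_fin_succ,
      Fin.forall_fin_succ, Fin.cons_zero, Fin.cons_succ, ne_eq, not_true_eq_false, Fin.succ_ne_zero,
      not_false_eq_true, true_implies, Fin.succ_inj, false_implies, true_and,
      (Fin.succ_ne_zero _).symm, funext_iff]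
    grind

lemma isBipartite_completeGraph_two : (completeGraph (Fin 2)).IsBipartite :=
  ⟨Coloring.mk id fun h => h⟩

lemma cubeGraph_connected (n : ℕ) : (cubeGraph n).Connected := by
  induction n with
  | zero =>
    exact ⟨fun a b => by rw [Subsingleton.elim a b]⟩
  | succ n ih =>
    exact (boxProdCubeIso n).connected_iff.1 (connected_top.boxProd ih)

lemma isBipartite_cubeGraph (n : ℕ) : (cubeGraph n).IsBipartite := by
  induction n with
  | zero => exact isBipartite_of_side (s := 0) fun p q h => (h.ne (Subsingleton.elim p q)).elim
  | succ n ih =>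
    obtain ⟨s, hs⟩ := exists_side isBipartite_completeGraph_two
    obtain ⟨t, ht⟩ := exists_side ih
    exact (isBipartite_of_side (boxProd_side hs ht)).of_hom (boxProdCubeIso n).symm.toHom

lemma not_admitsVCEW_one_completeGraph_two : ¬ AdmitsVCEW (completeGraph (Fin 2)) 1 := by
  rw [admitsVCEW_one_iff]
  intro h
  refine h 0 1 (by simp [completeGraph]) ?_
  have e0 : nbrs (completeGraph (Fin 2)) 0 = {1} := by
    ext a; fin_cases a <;> simp [completeGraph]
  have e1 : nbrs (completeGraph (Fin 2)) 1 = {0} := by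
    ext a; fin_cases a <;> simp [completeGraph]
  rw [e0, e1, card_singleton, card_singleton]

end Families

end VCEW

theorem mainTheorem10 :
    (∀ {V : Type*} {W : Type*} [Fintype V] [Fintype W] [Nontrivial V] [Nontrivial W]
        (G : SimpleGraph V) (H : SimpleGraph W),
        G.Connected → H.Connected → G.IsBipartite → H.IsBipartite →
        (¬ VCEW.AdmitsVCEW G 1 ∨ ¬ VCEW.AdmitsVCEW H 1) →
        VCEW.mu (SimpleGraph.boxProd G H) = 2) ∧
    (∀ n m : ℕ, 3 ≤ n → 3 ≤ m → Even n → Even m →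
        VCEW.mu (SimpleGraph.boxProd (SimpleGraph.cycleGraph n) (SimpleGraph.cycleGraph m)) = 2) ∧
    (∀ n m : ℕ, 3 ≤ n → 2 ≤ m → Even n →
        VCEW.mu (SimpleGraph.boxProd (SimpleGraph.cycleGraph n) (SimpleGraph.pathGraph m)) = 2) ∧
    (∀ n m : ℕ, 2 ≤ n → 2 ≤ m → ¬ (n = 3 ∧ m = 3) →
        VCEW.mu (SimpleGraph.boxProd (SimpleGraph.pathGraph n) (SimpleGraph.pathGraph m)) = 2) ∧
    (∀ n : ℕ, 2 ≤ n → VCEW.mu (VCEW.cubeGraph n) = 2) := by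
  refine ⟨fun G H hG hH hG' hH' h => VCEW.mu_boxProd_eq_two hG hH hG' hH' h,
    fun n m hn hm hne hme => ?_, fun n m hn hm hne => ?_, fun n m hn hm hnm => ?_, fun n hn => ?_⟩
  · have := Fin.nontrivial_iff_two_le.2 (show 2 ≤ n by omega)
    have := Fin.nontrivial_iff_two_le.2 (show 2 ≤ m by omega)
    exact VCEW.mu_boxProd_eq_two (VCEW.cycleGraph_connected_of_pos (by omega))
      (VCEW.cycleGraph_connected_of_pos (by omega)) (VCEW.isBipartite_cycleGraph hne)
      (VCEW.isBipartite_cycleGraph hme) (Or.inl (VCEW.not_admitsVCEW_one_cycleGraph hn))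
  · have := Fin.nontrivial_iff_two_le.2 (show 2 ≤ n by omega)
    have := Fin.nontrivial_iff_two_le.2 hm
    exact VCEW.mu_boxProd_eq_two (VCEW.cycleGraph_connected_of_pos (by omega))
      (VCEW.pathGraph_connected_of_pos (by omega)) (VCEW.isBipartite_cycleGraph hne)
      (VCEW.isBipartite_pathGraph m) (Or.inl (VCEW.not_admitsVCEW_one_cycleGraph hn))
  · have := Fin.nontrivial_iff_two_le.2 hn
    have := Fin.nontrivial_iff_two_le.2 hm
    refine VCEW.mu_boxProd_eq_two (VCEW.pathGraph_connected_of_pos (by omega))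
      (VCEW.pathGraph_connected_of_pos (by omega)) (VCEW.isBipartite_pathGraph n)
      (VCEW.isBipartite_pathGraph m) ?_
    by_cases h3 : n = 3
    · exact Or.inr (VCEW.not_admitsVCEW_one_pathGraph hm fun h => hnm ⟨h3, h⟩)
    · exact Or.inl (VCEW.not_admitsVCEW_one_pathGraph hn h3)
  · obtain ⟨k, rfl⟩ := Nat.exists_eq_add_of_le' hn
    rw [← VCEW.mu_eq_of_iso (VCEW.boxProdCubeIso (k + 1))]
    exact VCEW.mu_boxProd_eq_two SimpleGraph.connected_top (VCEW.cubeGraph_connected _)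
      VCEW.isBipartite_completeGraph_two (VCEW.isBipartite_cubeGraph _)
      (Or.inl VCEW.not_admitsVCEW_one_completeGraph_two)
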